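/- Let $n\ge 1$ and $d\ge 0$ be integers and let $\mathbb B^n=\{z\in\mathbb C^n: |z|^2=\sum_i|z_i|^2<1\}$, with Lebesgue measure $dV$. For a bounded domain $D\subset\mathbb C^n$ and a measurable weight $\phi\ge 0$ on $D$ with $1/\phi$ locally bounded, let $A^2_\phi(D)$ be the space of holomorphic $f$ on $D$ with $\int_D|f|^2\phi\,dV<\infty$. Its reproducing kernel $K_{D,\phi}(z,w)$ is determined by the properties $K_{D,\phi}(\cdot,w)\in A^2_\phi(D)$, $K_{D,\phi}(z,w)=\overline{K_{D,\phi}(w,z)}$ and $f(z)=\int_D K_{D,\phi}(z,w)f(w)\phi(w)\,dV(w)$ for all $f\in A^2_\phi(D)$. Let $K_D(z)=K_{D,1}(z,z)$ be the Bergman kernel on the diagonal, let $K_{D,d}(z,w)$ be the reproducing kernel for the weight $\phi=K_D^{-d}$, and put $K_{D,d}(z)=K_{D,d}(z,z)$. Put $$g^{D,d}_{\alpha\bar\beta}=\frac{\partial^2\log K_{D,d}}{\partial z_\alpha\partial\bar z_\beta},\quad G_{D,d}=\big(g^{D,d}_{\alpha\bar\beta}\big),\quad g_{D,d}=\det G_{D,d},\quad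 \beta_{D,d}=g_{D,d}\,K_{D,d}^{-1/(d+1)},$$ $$R^{D,d}_{\bar\alpha\beta\gamma\bar\delta}=-\frac{\partial^2 g^{D,d}_{\beta\bar\alpha}}{\partial z_\gamma\partial\bar z_\delta}+\sum_{\mu,\nu}g_{D,d}^{\nu\bar\mu}\,\frac{\partial g^{D,d}_{\beta\bar\mu}}{\partial z_\gamma}\,\frac{\partial g^{D,d}_{\nu\bar\alpha}}{\partial\bar z_\delta},\qquad \sum_\mu g^{D,d}_{\beta\bar\mu}\,g_{D,d}^{\nu\bar\mu}=\delta_{\beta\nu},$$ $$R_{D,d}(z,v)=\frac{\sum R^{D,d}_{\bar\alpha\beta\gamma\bar\delta}(z)\,\bar v^\alpha v^\beta v^\gamma\bar v^\delta}{\big(\sum g^{D,d}_{\alpha\bar\beta}(z)v^\alpha\bar v^\beta\big)^2},\qquad \operatorname{Ric}_{D,d}(z,v)=\frac{-\sum \frac{\partial^2\log g_{D,d}}{\partial z_\alpha\partial\bar z_\beta}(z)\,v^\alpha\bar v^\beta}{\sum g^{D,d}_{\alpha\bar\beta}(z)v^\alpha\bar v^\beta}.$$ Then the kernel $K_{\mathbb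 B^n,d}$ exists and, with $c=\dfrac{\Gamma((d+1)(n+1))}{n!\,\Gamma(d(n+1)+1)}$, for all $z\in\mathbb B^n$ and $v\in\mathbb C^n\setminus\{0\}$, $$K_{\mathbb B^n,d}(z)=c\Big(\frac{n!}{\pi^n}\Big)^{d+1}\frac1{(1-|z|^2)^{(d+1)(n+1)}},$$ $$g^{\mathbb B^n,d}_{\alpha\bar\beta}(z)=(d+1)(n+1)\Big(\frac{\delta_{\alpha\beta}}{1-|z|^2}+\frac{\bar z_\alpha z_\beta}{(1-|z|^2)^2}\Big)\quad(1\le\alpha,\beta\le n),$$ $$g_{\mathbb B^n,d}(z)=\frac{(d+1)^n(n+1)^n}{(1-|z|^2)^{n+1}},$$ $$\beta_{\mathbb B^n,d}(z)=(d+1)^n(n+1)^n\Big(\frac1c\Big)^{1/(d+1)}\frac{\pi^n}{n!},$$ $$R_{\mathbb B^n,d}(z,v)=-\frac{2}{(d+1)(n+1)},\qquad \operatorname{Ric}_{\mathbb B^n,d}(z,v)=-\frac1{d+1}.$$ -/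

import Mathlib

/-!
Points of `ℂⁿ` are functions `Fin n → ℂ`. Only the topology and the (product) Lebesgue measure
`volume` of this type are used below; the Euclidean length is always written out as a sum of squares.
-/

namespace NarasimhanSimha

open MeasureTheory

/-- The weighted Bergman space `A²_φ(D)`: holomorphic functions on `D` that are square integrable
with respect to `φ dV`. Functions are defined on all of `ℂⁿ`, but only their values on `D` matter. -/
def MemBergmanSpace {n : ℕ} (D : Set (Fin n → ℂ)) (φ : (Fin n → ℂ) → ℝ)
    (f : (Fin n → ℂ) → ℂ) : Prop :=
  DifferentiableOn ℂ f D ∧ IntegrableOn (fun z => ‖f z‖ ^ 2 * φ z) D volume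

/-- `K` is the reproducing kernel of `A²_φ(D)`: each `K(·, w)` lies in `A²_φ(D)`, `K` is
anti-symmetric, and `f(z) = ∫_D K(z, w) f(w) φ(w) dV(w)` for all `f` in `A²_φ(D)`. -/
structure IsWeightedBergmanKernel {n : ℕ} (D : Set (Fin n → ℂ)) (φ : (Fin n → ℂ) → ℝ)
    (K : (Fin n → ℂ) → (Fin n → ℂ) → ℂ) : Prop where
  mem : ∀ w ∈ D, MemBergmanSpace D φ (fun z => K z w)
  antisymm : ∀ z ∈ D, ∀ w ∈ D, K z w = starRingEnd ℂ (K w z)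
  reproducing : ∀ f, MemBergmanSpace D φ f → ∀ z ∈ D, f z = ∫ w in D, K z w * f w * (φ w : ℂ)

/-- The defining properties determine the kernel on `D × D`. -/
theorem IsWeightedBergmanKernel.unique {n : ℕ} {D : Set (Fin n → ℂ)} (hD : MeasurableSet D)
    {φ : (Fin n → ℂ) → ℝ} {K L : (Fin n → ℂ) → (Fin n → ℂ) → ℂ}
    (hK : IsWeightedBergmanKernel D φ K) (hL : IsWeightedBergmanKernel D φ L)
    {z w : Fin n → ℂ} (hz : z ∈ D) (hw : w ∈ D) : K z w = L z w := by
  rw [hK.antisymm z hz w hw, hL.reproducing _ (hK.mem z hz) w hw,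
    hK.reproducing _ (hL.mem w hw) z hz, ← integral_conj]
  refine setIntegral_congr_fun hD fun u hu => ?_
  simp only [map_mul, Complex.conj_ofReal]
  rw [← hL.antisymm u hu w hw, ← hK.antisymm z hz u hu]
  ring

open Classical in
/-- The weighted Bergman kernel `K_{D,φ}(z, w)`, for `z` and `w` in `D`
(by convention zero if no reproducing kernel exists). -/
noncomputable def weightedBergmanKernel {n : ℕ} (D : Set (Fin n → ℂ)) (φ : (Fin n → ℂ) → ℝ) :
    (Fin n → ℂ) → (Fin n → ℂ) → ℂ :=
  if h : ∃ K, IsWeightedBergmanKernel D φ K then h.choose else 0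

/-- The Bergman kernel on the diagonal, `K_D(z) = K_D(z, z)`, a real number by anti-symmetry. -/
noncomputable def bergmanDiag {n : ℕ} (D : Set (Fin n → ℂ)) (z : Fin n → ℂ) : ℝ :=
  (weightedBergmanKernel D (fun _ => 1) z z).re

/-- The weight `K_D^{-d}`. -/
noncomputable def nsWeight {n : ℕ} (D : Set (Fin n → ℂ)) (d : ℕ) (z : Fin n → ℂ) : ℝ :=
  (bergmanDiag D z ^ d)⁻¹

/-- The weighted kernel of order `d`, `K_{D,d}(z, w)`: the kernel for the weight `K_D^{-d}`. -/
noncomputable def nsKernel {n : ℕ} (D : Set (Fin n → ℂ)) (d : ℕ) :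
    (Fin n → ℂ) → (Fin n → ℂ) → ℂ :=
  weightedBergmanKernel D (nsWeight D d)

/-- `K_{D,d}(z) = K_{D,d}(z, z)`, a real number by anti-symmetry. -/
noncomputable def nsDiag {n : ℕ} (D : Set (Fin n → ℂ)) (d : ℕ) (z : Fin n → ℂ) : ℝ :=
  (nsKernel D d z z).re

/-- The Wirtinger derivative `∂f/∂z_α = (∂f/∂x_α - i ∂f/∂y_α) / 2`. -/
noncomputable def dz {n : ℕ} (α : Fin n) (f : (Fin n → ℂ) → ℂ) (z : Fin n → ℂ) : ℂ :=
  (fderiv ℝ f z (Pi.single α 1) - Complex.I * fderiv ℝ f z (Pi.single α Complex.I)) / 2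

/-- The Wirtinger derivative `∂f/∂z̄_α = (∂f/∂x_α + i ∂f/∂y_α) / 2`. -/
noncomputable def dzbar {n : ℕ} (α : Fin n) (f : (Fin n → ℂ) → ℂ) (z : Fin n → ℂ) : ℂ :=
  (fderiv ℝ f z (Pi.single α 1) + Complex.I * fderiv ℝ f z (Pi.single α Complex.I)) / 2

/-- The matrix `G_{D,d}(z)` with entries `g_{αβ̄}(z) = ∂²/∂z_α∂z̄_β log K_{D,d}(z)`. -/
noncomputable def nsMetric {n : ℕ} (D : Set (Fin n → ℂ)) (d : ℕ) (z : Fin n → ℂ) :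
    Matrix (Fin n) (Fin n) ℂ :=
  Matrix.of fun α β => dz α (dzbar β (fun w => ((Real.log (nsDiag D d w) : ℝ) : ℂ))) z

/-- The volume density `g_{D,d}(z) = det G_{D,d}(z)`, a real number because `G_{D,d}(z)` is
Hermitian. -/
noncomputable def nsVolume {n : ℕ} (D : Set (Fin n → ℂ)) (d : ℕ) (z : Fin n → ℂ) : ℝ :=
  (nsMetric D d z).det.re

/-- The biholomorphic invariant `β_{D,d}(z) = g_{D,d}(z) K_{D,d}(z)^{-1/(d+1)}`. -/
noncomputable def nsBeta {n : ℕ} (D : Set (Fin n → ℂ)) (d : ℕ) (z : Fin n → ℂ) : ℝ :=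
  nsVolume D d z * nsDiag D d z ^ (-(1 / ((d : ℝ) + 1)))

/-- The squared length `∑ g_{αβ̄}(z) v^α v̄^β` of a vector. -/
noncomputable def nsLengthSq {n : ℕ} (D : Set (Fin n → ℂ)) (d : ℕ) (z v : Fin n → ℂ) : ℂ :=
  ∑ α, ∑ β, nsMetric D d z α β * v α * starRingEnd ℂ (v β)

/-- The curvature tensor
`R_{ᾱβγδ̄} = - ∂²g_{βᾱ}/∂z_γ∂z̄_δ + ∑_{μ,ν} g^{νμ̄} (∂g_{βμ̄}/∂z_γ) (∂g_{νᾱ}/∂z̄_δ)`,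
where `g^{νμ̄}` are the numbers with `∑_μ g_{βμ̄} g^{νμ̄} = δ_{βν}`, so that `g^{νμ̄}` stands in
row `μ` and column `ν` of the inverse of `G_{D,d}(z)`. -/
noncomputable def nsCurvature {n : ℕ} (D : Set (Fin n → ℂ)) (d : ℕ) (z : Fin n → ℂ)
    (α β γ δ : Fin n) : ℂ :=
  -dz γ (dzbar δ (fun w => nsMetric D d w β α)) z +
    ∑ μ, ∑ ν, (nsMetric D d z)⁻¹ μ ν * dz γ (fun w => nsMetric D d w β μ) z *
      dzbar δ (fun w => nsMetric D d w ν α) z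

/-- The holomorphic sectional curvature `R_{D,d}(z, v)`. -/
noncomputable def nsHolSecCurv {n : ℕ} (D : Set (Fin n → ℂ)) (d : ℕ) (z v : Fin n → ℂ) : ℂ :=
  (∑ α, ∑ β, ∑ γ, ∑ δ, nsCurvature D d z α β γ δ *
      starRingEnd ℂ (v α) * v β * v γ * starRingEnd ℂ (v δ)) / nsLengthSq D d z v ^ 2

/-- The Ricci tensor `Ric_{αβ̄} = - ∂²/∂z_α∂z̄_β log g_{D,d}`. -/
noncomputable def nsRicciTensor {n : ℕ} (D : Set (Fin n → ℂ)) (d : ℕ) (z : Fin n → ℂ)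
    (α β : Fin n) : ℂ :=
  -dz α (dzbar β (fun w => ((Real.log (nsVolume D d w) : ℝ) : ℂ))) z

/-- The Ricci curvature `Ric_{D,d}(z, v)`. -/
noncomputable def nsRicci {n : ℕ} (D : Set (Fin n → ℂ)) (d : ℕ) (z v : Fin n → ℂ) : ℂ :=
  (∑ α, ∑ β, nsRicciTensor D d z α β * v α * starRingEnd ℂ (v β)) / nsLengthSq D d z v

/-- The Euclidean length squared `|z|² = ∑ |z_i|²`. -/
noncomputable def normSq {n : ℕ} (z : Fin n → ℂ) : ℝ := ∑ i, ‖z i‖ ^ 2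

/-- The Euclidean unit ball of `ℂⁿ`. -/
def unitBall (n : ℕ) : Set (Fin n → ℂ) := {z | normSq z < 1}

/-- The constant `c = Γ((d+1)(n+1)) / (n! Γ(d(n+1)+1))`. -/
noncomputable def nsConst (n d : ℕ) : ℝ :=
  Real.Gamma (((d : ℝ) + 1) * ((n : ℝ) + 1)) /
    ((n.factorial : ℝ) * Real.Gamma ((d : ℝ) * ((n : ℝ) + 1) + 1))

end NarasimhanSimha

namespace NarasimhanSimha

open MeasureTheory Complex Set
open scoped Real ComplexConjugate Topology

/-! The unit ball is homogeneous, so every weight `c (1 - |z|²)ᵃ` has an explicit kernel. At the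
centre, the reproducing property is the mean value property against a radial weight
(`integral_ball_radial`), with total mass found by slicing a higher-dimensional ball. The involution
`ballMobius z` carries the centre to `z`; its Jacobian and the transformation rule for `1 - |w|²`
turn the reproducing integral at `z` into that mean value (`isWeightedBergmanKernel_unitBall`). The
case `a = 0` gives `K_D`, so `K_D^{-d}` is again such a weight, with `a = d (n + 1)`, and the same
lemma gives the kernel of order `d`. On the diagonal it is a constant times a power of `1 - |z|²`.
The metric is therefore a scalar multiple of the identity plus a rank one matrix, which yields its
determinant and inverse. The curvature tensor comes out as `-(g g + g g)/N` with `N = (d + 1)(n +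
1)`, and `log g` is `log K` divided by `d + 1` up to a constant, so both curvatures are constant. -/

/-! ### Volumes and radial integrals on the ball. -/

theorem volume_sum_norm_sq_lt (ι : Type*) [Fintype ι] {t : ℝ} (ht : 0 < t) :
    volume {z : ι → ℂ | ∑ i, ‖z i‖ ^ 2 < t} =
      ENNReal.ofReal (t ^ Fintype.card ι * (π ^ Fintype.card ι / (Fintype.card ι).factorial)) := by
  rcases isEmpty_or_nonempty ι with hι | hι
  · have h : {z : ι → ℂ | ∑ i, ‖z i‖ ^ 2 < t} = univ := by
      ext z; simpa using ht
    rw [h]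
    simp [volume_pi]
  · have h := Complex.volume_sum_rpow_lt ι (p := 2) (by norm_num) (Real.sqrt t)
    have hs : {x : ι → ℂ | (∑ i, ‖x i‖ ^ (2 : ℝ)) ^ (1 / (2 : ℝ)) < Real.sqrt t} =
        {z : ι → ℂ | ∑ i, ‖z i‖ ^ 2 < t} := by
      ext z
      simp only [mem_ofPred_eq, Real.rpow_ofNat, ← Real.sqrt_eq_rpow]
      exact Real.sqrt_lt_sqrt_iff (Finset.sum_nonneg fun i _ => by positivity)
    have h1 : Real.Gamma (2 / 2 + 1) = 1 := by norm_num
    have h2 : Real.Gamma (2 * (Fintype.card ι : ℝ) / 2 + 1) = (Fintype.card ι).factorial := by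
      rw [mul_div_cancel_left₀ _ two_ne_zero, Real.Gamma_nat_eq_factorial]
    rw [← hs, h, h1, h2, ← ENNReal.ofReal_pow (Real.sqrt_nonneg t), pow_mul,
      Real.sq_sqrt ht.le, mul_one, ENNReal.ofReal_mul (by positivity)]

theorem continuous_normSq {n : ℕ} : Continuous (normSq (n := n)) := by
  unfold normSq; fun_prop

theorem normSq_nonneg {n : ℕ} (z : Fin n → ℂ) : 0 ≤ normSq z :=
  Finset.sum_nonneg fun i _ => by positivity

theorem isOpen_unitBall (n : ℕ) : IsOpen (unitBall n) :=
  isOpen_lt continuous_normSq continuous_const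

theorem measurableSet_unitBall (n : ℕ) : MeasurableSet (unitBall n) :=
  (isOpen_unitBall n).measurableSet

theorem mem_unitBall {n : ℕ} {z : Fin n → ℂ} : z ∈ unitBall n ↔ normSq z < 1 := Iff.rfl

theorem volume_unitBall_lt_top (n : ℕ) : volume (unitBall n) < ⊤ := by
  have h : unitBall n = {z : Fin n → ℂ | ∑ i, ‖z i‖ ^ 2 < 1} := rfl
  rw [h, volume_sum_norm_sq_lt (Fin n) one_pos]
  exact ENNReal.ofReal_lt_top

/-- The integral of `(1 - |z|²)ᵃ`, obtained by slicing the unit ball of `ℂⁿ⁺ᵃ`. -/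
theorem lintegral_one_sub_normSq_pow (n a : ℕ) :
    ∫⁻ z in unitBall n, ENNReal.ofReal ((1 - normSq z) ^ a) =
      ENNReal.ofReal (π ^ n * a.factorial / (n + a).factorial) := by
  have hvol := volume_sum_norm_sq_lt (Fin n ⊕ Fin a) one_pos
  set S : Set ((Fin n → ℂ) × (Fin a → ℂ)) := {p | normSq p.1 + normSq p.2 < 1} with hS
  have hSm : MeasurableSet S :=
    (isOpen_lt ((continuous_normSq.comp continuous_fst).add
      (continuous_normSq.comp continuous_snd)) continuous_const).measurableSet
  have hpre : {z : Fin n ⊕ Fin a → ℂ | ∑ i, ‖z i‖ ^ 2 < 1} =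
      (MeasurableEquiv.sumPiEquivProdPi fun _ : Fin n ⊕ Fin a => ℂ) ⁻¹' S := by
    ext z
    simp [S, normSq, MeasurableEquiv.sumPiEquivProdPi, Equiv.sumPiEquivProdPi]
  rw [hpre, (volume_measurePreserving_sumPiEquivProdPi
    (fun _ : Fin n ⊕ Fin a => ℂ)).measure_preimage_equiv, Measure.volume_eq_prod,
    Measure.prod_apply hSm] at hvol
  -- The slice over `x` is a ball of `ℂᵃ` of squared radius `1 - |x|²`, empty once `|x| ≥ 1`.
  have hslice : ∀ x : Fin n → ℂ, volume (Prod.mk x ⁻¹' S) =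
      (unitBall n).indicator (fun x => ENNReal.ofReal (π ^ a / a.factorial) *
        ENNReal.ofReal ((1 - normSq x) ^ a)) x := by
    intro x
    have hx : Prod.mk x ⁻¹' S = {y : Fin a → ℂ | ∑ i, ‖y i‖ ^ 2 < 1 - normSq x} := by
      ext y
      simp only [hS, mem_preimage, mem_ofPred_eq, lt_sub_iff_add_lt']
      rfl
    rw [hx]
    by_cases h : x ∈ unitBall n
    · have h' : 0 < 1 - normSq x := sub_pos.2 h
      rw [indicator_of_mem h, volume_sum_norm_sq_lt _ h', mul_comm,
        ENNReal.ofReal_mul (by positivity)]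
      simp
    · rw [indicator_of_notMem h]
      have h' : 1 ≤ normSq x := not_lt.1 h
      convert measure_empty (μ := volume)
      ext y
      simp only [mem_ofPred_eq, mem_empty_iff_false, iff_false, not_lt]
      exact (sub_nonpos.2 h').trans (normSq_nonneg y)
  simp_rw [hslice] at hvol
  rw [lintegral_indicator (measurableSet_unitBall n), lintegral_const_mul' _ _ (by simp)] at hvol
  have hc : 0 < π ^ a / (a.factorial : ℝ) := by positivity
  have hc' : ENNReal.ofReal (π ^ a / (a.factorial : ℝ)) ≠ 0 := by simpa using hc
  rw [← ENNReal.mul_right_inj hc' ENNReal.ofReal_ne_top, hvol, ← ENNReal.ofReal_mul hc.le]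
  congr 1
  simp only [Fintype.card_sum, Fintype.card_fin, one_pow, one_mul, pow_add]
  field_simp

theorem integral_one_sub_normSq_pow (n a : ℕ) :
    ∫ z in unitBall n, (1 - normSq z) ^ a = π ^ n * a.factorial / (n + a).factorial := by
  rw [integral_eq_lintegral_of_nonneg_ae, lintegral_one_sub_normSq_pow,
    ENNReal.toReal_ofReal (by positivity)]
  · filter_upwards [ae_restrict_mem (measurableSet_unitBall n)] with z hz
    exact pow_nonneg (sub_nonneg.2 (mem_unitBall.1 hz).le) _
  · exact ((continuous_const.sub continuous_normSq).pow a).aestronglyMeasurable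

/-! ### Circle averages and the mean value property. -/

theorem normSq_smul {n : ℕ} (c : ℂ) (z : Fin n → ℂ) : normSq (c • z) = ‖c‖ ^ 2 * normSq z := by
  simp [normSq, Finset.mul_sum, mul_pow]

/-- Multiplication by a unimodular scalar preserves Lebesgue measure on `ℂⁿ`. -/
theorem measurePreserving_smul_of_norm_eq_one {n : ℕ} {c : ℂ} (hc : ‖c‖ = 1) :
    MeasurePreserving (fun z : Fin n → ℂ => c • z) := by
  have h : MeasurePreserving (fun z : ℂ => c * z) := by
    have := (rotation ⟨c, mem_sphere_zero_iff_norm.2 hc⟩).measurePreserving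
    convert this using 1
    rfl
  exact volume_preserving_pi (fun _ : Fin n => h)

/-- The weighted mean value property of holomorphic functions on the ball. -/
theorem integral_ball_radial {n : ℕ} {f : (Fin n → ℂ) → ℂ} (hf : DifferentiableOn ℂ f (unitBall n))
    {a : ℕ} (hfi : IntegrableOn (fun z => f z * ((1 - normSq z : ℝ) : ℂ) ^ a) (unitBall n)) :
    ∫ z in unitBall n, f z * ((1 - normSq z : ℝ) : ℂ) ^ a =
      f 0 * ((π ^ n * a.factorial / (n + a).factorial : ℝ) : ℂ) := by
  classical
  set F : (Fin n → ℂ) → ℂ :=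
    (unitBall n).indicator (fun z => f z * ((1 - normSq z : ℝ) : ℂ) ^ a) with hF
  have hFi : Integrable F := hfi.integrable_indicator (measurableSet_unitBall n)
  have hFm : Measurable F := by
    have hcont : Continuous fun z : Fin n → ℂ => ((1 - normSq z : ℝ) : ℂ) ^ a :=
      (continuous_ofReal.comp (continuous_const.sub continuous_normSq)).pow a
    exact ContinuousOn.measurable_piecewise (hf.continuousOn.mul hcont.continuousOn)
      continuous_zero.continuousOn (measurableSet_unitBall n)
  have hmp : ∀ θ : ℝ, MeasurePreserving (fun z : Fin n → ℂ => circleMap 0 1 θ • z) := fun θ =>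
    measurePreserving_smul_of_norm_eq_one (by simp)
  have hme : ∀ θ : ℝ, MeasurableEmbedding (fun z : Fin n → ℂ => circleMap 0 1 θ • z) := fun θ =>
    (Homeomorph.smulOfNeZero (circleMap 0 1 θ) (circleMap_ne_center one_ne_zero)).measurableEmbedding
  have hrot : ∀ θ : ℝ, ∫ z, F (circleMap 0 1 θ • z) = ∫ z, F z := fun θ =>
    (hmp θ).integral_comp (hme θ) F
  have hrotn : ∀ θ : ℝ, ∫ z, ‖F (circleMap 0 1 θ • z)‖ = ∫ z, ‖F z‖ := fun θ =>
    (hmp θ).integral_comp (hme θ) (fun z => ‖F z‖)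
  have hmeas : Measurable (Function.uncurry fun (θ : ℝ) (z : Fin n → ℂ) =>
      F (circleMap 0 1 θ • z)) := by
    refine hFm.comp (Continuous.measurable ?_)
    exact ((continuous_circleMap 0 1).comp continuous_fst).smul continuous_snd
  have hint : Integrable (Function.uncurry fun (θ : ℝ) (z : Fin n → ℂ) =>
      F (circleMap 0 1 θ • z)) ((volume.restrict (Ioc 0 (2 * π))).prod volume) := by
    rw [integrable_prod_iff hmeas.aestronglyMeasurable]
    refine ⟨.of_forall fun θ => (hmp θ).integrable_comp_of_integrable hFi, ?_⟩
    simp only [Function.uncurry_apply_pair, hrotn]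
    exact integrable_const _
  -- Fubini: integrating over `z` first gives `2π ∫ F` by rotation invariance; integrating over `θ`
  -- first averages `f` over circles.
  have hswap := integral_integral_swap hint
  simp only [hrot] at hswap
  have hinner : ∀ z, ∫ θ in Ioc 0 (2 * π), F (circleMap 0 1 θ • z) =
      (2 * π : ℂ) * (f 0 * (unitBall n).indicator (fun z => ((1 - normSq z : ℝ) : ℂ) ^ a) z) := by
    intro z
    have hnorm : ∀ θ : ℝ, normSq (circleMap 0 1 θ • z) = normSq z := fun θ => by
      simp [normSq_smul]
    by_cases hz : z ∈ unitBall n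
    · have hmem : ∀ θ : ℝ, circleMap 0 1 θ • z ∈ unitBall n := fun θ => by
        rw [mem_unitBall, hnorm]; exact hz
      -- The closed unit disc times `z` stays inside the open ball, so the circle average of `f (c •
      -- z)` is its value at `c = 0`, whatever `z` is.
      have hd : DiffContOnCl ℂ (fun c : ℂ => f (c • z)) (Metric.ball 0 |1|) := by
        refine DifferentiableOn.diffContOnCl fun c hc => DifferentiableAt.differentiableWithinAt ?_
        have hc1 : ‖c‖ ≤ 1 := by
          simpa using Metric.closure_ball_subset_closedBall hc
        have hcz : c • z ∈ unitBall n := by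
          rw [mem_unitBall, normSq_smul]
          have hz' : normSq z < 1 := hz
          have := normSq_nonneg z
          have h2 : ‖c‖ ^ 2 ≤ 1 := pow_le_one₀ (norm_nonneg c) hc1
          nlinarith
        exact (hf.differentiableAt ((isOpen_unitBall n).mem_nhds hcz)).comp c
          (differentiableAt_id.smul_const z)
      have havg := hd.circleAverage
      rw [Real.circleAverage_def, intervalIntegral.integral_of_le (by positivity)] at havg
      have : ∫ θ in Ioc 0 (2 * π), F (circleMap 0 1 θ • z) =
          (∫ θ in Ioc 0 (2 * π), f (circleMap 0 1 θ • z)) * ((1 - normSq z : ℝ) : ℂ) ^ a := by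
        rw [← integral_mul_const]
        refine integral_congr_ae (.of_forall fun θ => ?_)
        simp only [hF]
        rw [indicator_of_mem (hmem θ), hnorm]
      rw [this, indicator_of_mem hz]
      simp only [zero_smul] at havg
      rw [← havg, real_smul]
      have : (π : ℂ) ≠ 0 := by exact_mod_cast Real.pi_ne_zero
      push_cast
      field_simp
    · rw [indicator_of_notMem hz, mul_zero, mul_zero]
      refine integral_eq_zero_of_ae (.of_forall fun θ => ?_)
      simp only [hF]
      rw [indicator_of_notMem]
      · rfl
      · rw [mem_unitBall, hnorm]; exact hz
  simp only [hinner] at hswap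
  rw [integral_const_mul, integral_const_mul, integral_const, hF,
    integral_indicator (measurableSet_unitBall n), integral_indicator (measurableSet_unitBall n)] at hswap
  have hw : ∫ z in unitBall n, ((1 - normSq z : ℝ) : ℂ) ^ a =
      ((π ^ n * a.factorial / (n + a).factorial : ℝ) : ℂ) := by
    rw [← integral_one_sub_normSq_pow n a]
    refine Eq.trans ?_ integral_ofReal
    simp
  rw [hw] at hswap
  have h2 : (volume.restrict (Ioc 0 (2 * π))).real univ = 2 * π := by
    simp [Real.pi_pos.le, measureReal_def]
  rw [h2, real_smul] at hswap
  have : (2 * π : ℂ) ≠ 0 := by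
    exact mul_ne_zero two_ne_zero (by exact_mod_cast Real.pi_ne_zero)
  exact mul_left_cancel₀ this (by push_cast at hswap ⊢; exact hswap)

/-! ### The Hermitian pairing and the automorphisms of the ball. -/

/-- The Hermitian pairing `∑ wᵢ z̄ᵢ`, as a continuous linear form in `w`. -/
noncomputable def herm {n : ℕ} (z : Fin n → ℂ) : (Fin n → ℂ) →L[ℂ] ℂ :=
  ∑ i, conj (z i) • ContinuousLinearMap.proj i

theorem herm_apply {n : ℕ} (z w : Fin n → ℂ) : herm z w = ∑ i, w i * conj (z i) := by
  simp [herm, mul_comm]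

theorem herm_self {n : ℕ} (z : Fin n → ℂ) : herm z z = (normSq z : ℂ) := by
  simp [herm_apply, normSq, Complex.mul_conj']

theorem conj_herm {n : ℕ} (z w : Fin n → ℂ) : conj (herm z w) = herm w z := by
  simp [herm_apply, mul_comm]

theorem norm_herm_sq_le {n : ℕ} (z w : Fin n → ℂ) : ‖herm z w‖ ^ 2 ≤ normSq z * normSq w := by
  have h : ‖herm z w‖ ≤ ∑ i, ‖z i‖ * ‖w i‖ := by
    rw [herm_apply]
    refine (norm_sum_le _ _).trans_eq (Finset.sum_congr rfl fun i _ => ?_)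
    simp [mul_comm]
  exact (pow_le_pow_left₀ (norm_nonneg _) h 2).trans (Finset.sum_mul_sq_le_sq_mul_sq _ _ _)

theorem norm_herm_lt_one {n : ℕ} {z w : Fin n → ℂ} (hz : z ∈ unitBall n) (hw : w ∈ unitBall n) :
    ‖herm z w‖ < 1 := by
  have h := norm_herm_sq_le z w
  have hz' : normSq z < 1 := hz
  have hw' : normSq w < 1 := hw
  have := normSq_nonneg z
  have := normSq_nonneg w
  have : ‖herm z w‖ ^ 2 < 1 := by nlinarith
  exact (sq_lt_one_iff₀ (norm_nonneg _)).1 this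

theorem one_sub_ne_zero_of_norm_lt_one {t : ℂ} (ht : ‖t‖ < 1) : 1 - t ≠ 0 := by
  intro h
  rw [← sub_eq_zero.1 h] at ht
  simp at ht

theorem one_sub_herm_ne_zero {n : ℕ} {z w : Fin n → ℂ} (hz : z ∈ unitBall n)
    (hw : w ∈ unitBall n) : 1 - herm z w ≠ 0 :=
  one_sub_ne_zero_of_norm_lt_one (norm_herm_lt_one hz hw)

/-- The involutive automorphism of the unit ball that exchanges `0` and `z`. -/
noncomputable def ballMobius {n : ℕ} (z w : Fin n → ℂ) : Fin n → ℂ :=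
  (1 - herm z w)⁻¹ • (z - (√(1 - normSq z) : ℂ) • w -
    (herm z w / (1 + (√(1 - normSq z) : ℂ))) • z)

theorem exists_sqrt_one_sub_normSq {n : ℕ} {z : Fin n → ℂ} (hz : z ∈ unitBall n) :
    0 < √(1 - normSq z) ∧ (normSq z : ℂ) = 1 - (√(1 - normSq z) : ℂ) ^ 2 := by
  have h : 0 < 1 - normSq z := sub_pos.2 hz
  refine ⟨Real.sqrt_pos.2 h, ?_⟩
  rw [← ofReal_pow, Real.sq_sqrt h.le]
  push_cast
  ring

theorem one_add_ofReal_ne_zero {s : ℝ} (hs : 0 < s) : (1 + (s : ℂ)) ≠ 0 := by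
  exact_mod_cast (by positivity : (1 + s) ≠ 0)

/-- With `s = √(1 - |z|²)`, substituting `|z|² = 1 - s²` makes this a rational identity. The
involution property, the Jacobian and the kernel transformation all use it. -/
theorem one_sub_herm_ballMobius {n : ℕ} {z w : Fin n → ℂ} (hz : z ∈ unitBall n)
    (hw : w ∈ unitBall n) :
    1 - herm z (ballMobius z w) = (1 - (normSq z : ℂ)) / (1 - herm z w) := by
  obtain ⟨hs, hs2⟩ := exists_sqrt_one_sub_normSq hz
  have h1 := one_add_ofReal_ne_zero hs
  have h2 := one_sub_herm_ne_zero hz hw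
  simp only [ballMobius, map_smul, map_sub, herm_self, smul_eq_mul]
  rw [hs2]
  set s : ℂ := (√(1 - normSq z) : ℂ)
  field_simp
  ring

theorem one_sub_normSq_ballMobius {n : ℕ} {z w : Fin n → ℂ} (hz : z ∈ unitBall n)
    (hw : w ∈ unitBall n) :
    1 - normSq (ballMobius z w) =
      (1 - normSq z) * (1 - normSq w) / ‖1 - herm z w‖ ^ 2 := by
  obtain ⟨hs, hs2⟩ := exists_sqrt_one_sub_normSq hz
  have h1 := one_add_ofReal_ne_zero hs
  have h2 := one_sub_herm_ne_zero hz hw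
  have h3 : 1 - herm w z ≠ 0 := one_sub_herm_ne_zero hw hz
  rw [← ofReal_inj]
  push_cast
  rw [← herm_self (ballMobius z w), ← Complex.mul_conj' (1 - herm z w), map_sub, map_one, conj_herm]
  -- Only the second slot is expanded here; `hl` then expands the conjugate-linear first slot.
  have hr : herm (ballMobius z w) (ballMobius z w) = (1 - herm z w)⁻¹ * (herm (ballMobius z w) z -
      √(1 - normSq z) * herm (ballMobius z w) w -
      herm z w / (1 + (√(1 - normSq z) : ℂ)) * herm (ballMobius z w) z) := by
    conv_lhs => rw [show herm (ballMobius z w) (ballMobius z w) = herm (ballMobius z w)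
      ((1 - herm z w)⁻¹ • (z - (√(1 - normSq z) : ℂ) • w -
        (herm z w / (1 + (√(1 - normSq z) : ℂ))) • z)) from rfl]
    simp only [map_smul, map_sub, smul_eq_mul]
  have hl : ∀ v, herm (ballMobius z w) v = (1 - herm w z)⁻¹ * (herm z v -
      √(1 - normSq z) * herm w v - herm w z / (1 + (√(1 - normSq z) : ℂ)) * herm z v) := by
    intro v
    rw [← conj_herm v]
    simp only [ballMobius, map_smul, map_sub, smul_eq_mul, map_mul, map_inv₀, map_div₀, map_add,
      map_one, conj_ofReal, conj_herm]
  rw [hr, hl z, hl w, herm_self, herm_self]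
  set s : ℂ := (√(1 - normSq z) : ℂ)
  rw [hs2]
  field_simp
  ring

theorem ballMobius_mem {n : ℕ} {z w : Fin n → ℂ} (hz : z ∈ unitBall n) (hw : w ∈ unitBall n) :
    ballMobius z w ∈ unitBall n := by
  have h := one_sub_normSq_ballMobius hz hw
  have h1 : 0 < 1 - normSq z := sub_pos.2 hz
  have h2 : 0 < 1 - normSq w := sub_pos.2 hw
  have h3 : 0 < ‖1 - herm z w‖ := norm_pos_iff.2 (one_sub_herm_ne_zero hz hw)
  rw [mem_unitBall, ← sub_pos, h]
  positivity

theorem ballMobius_ballMobius {n : ℕ} {z w : Fin n → ℂ} (hz : z ∈ unitBall n)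
    (hw : w ∈ unitBall n) : ballMobius z (ballMobius z w) = w := by
  obtain ⟨hs, hs2⟩ := exists_sqrt_one_sub_normSq hz
  have h1 := one_add_ofReal_ne_zero hs
  have h2 := one_sub_herm_ne_zero hz hw
  have h3 : (√(1 - normSq z) : ℂ) ≠ 0 := by exact_mod_cast hs.ne'
  have h4 := one_sub_herm_ballMobius hz hw
  have h5 : herm z (ballMobius z w) = 1 - (1 - (normSq z : ℂ)) / (1 - herm z w) := by
    rw [← h4]; ring
  rw [ballMobius, h5]
  ext i
  simp only [ballMobius, Pi.smul_apply, Pi.sub_apply, smul_eq_mul]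
  rw [hs2]
  set s : ℂ := (√(1 - normSq z) : ℂ)
  field_simp
  ring

theorem ballMobius_zero {n : ℕ} (z : Fin n → ℂ) : ballMobius z 0 = z := by
  simp [ballMobius]

theorem image_ballMobius {n : ℕ} {z : Fin n → ℂ} (hz : z ∈ unitBall n) :
    ballMobius z '' unitBall n = unitBall n := by
  refine Subset.antisymm (image_subset_iff.2 fun w hw => ballMobius_mem hz hw) fun w hw => ?_
  exact ⟨ballMobius z w, ballMobius_mem hz hw, ballMobius_ballMobius hz hw⟩

theorem injOn_ballMobius {n : ℕ} {z : Fin n → ℂ} (hz : z ∈ unitBall n) :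
    InjOn (ballMobius z) (unitBall n) :=
  LeftInvOn.injOn (f₁' := ballMobius z) fun _ hw => ballMobius_ballMobius hz hw

/-- The complex derivative of `ballMobius z` at `w`. -/
noncomputable def ballMobiusDeriv {n : ℕ} (z w : Fin n → ℂ) : (Fin n → ℂ) →L[ℂ] (Fin n → ℂ) :=
  (-(√(1 - normSq z) : ℂ) * (1 - herm z w)⁻¹) • (ContinuousLinearMap.id ℂ _ +
    (herm z).smulRight ((√(1 - normSq z) : ℂ)⁻¹ •
      ((1 + (√(1 - normSq z) : ℂ))⁻¹ • z - ballMobius z w)))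

theorem hasFDerivAt_ballMobius {n : ℕ} {z w : Fin n → ℂ} (hz : z ∈ unitBall n)
    (hw : w ∈ unitBall n) : HasFDerivAt (ballMobius z) (ballMobiusDeriv z w) w := by
  obtain ⟨hs, -⟩ := exists_sqrt_one_sub_normSq hz
  have h1 := one_add_ofReal_ne_zero hs
  have h2 := one_sub_herm_ne_zero hz hw
  have h3 : (√(1 - normSq z) : ℂ) ≠ 0 := by exact_mod_cast hs.ne'
  have hl : HasFDerivAt (fun w => herm z w) (herm z) w := (herm z).hasFDerivAt
  have hi := (hasDerivAt_inv h2).comp_hasFDerivAt w (hl.const_sub 1)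
  have hn := (((hasFDerivAt_id w).const_smul (√(1 - normSq z) : ℂ)).const_sub z).sub
    ((hl.mul_const (1 + (√(1 - normSq z) : ℂ))⁻¹).smul_const z)
  refine (hi.smul hn).congr_fderiv ?_
  ext v i
  simp only [ballMobiusDeriv, ballMobius, Function.comp_apply, _root_.add_apply,
    _root_.smul_apply, _root_.sub_apply, _root_.neg_apply,
    ContinuousLinearMap.smulRight_apply, ContinuousLinearMap.id_apply, Pi.smul_apply,
    Pi.add_apply, Pi.sub_apply, Pi.neg_apply, smul_eq_mul, id]
  field_simp
  ring

theorem det_id_add_smulRight {n : ℕ} (l : (Fin n → ℂ) →L[ℂ] ℂ) (q : Fin n → ℂ) :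
    LinearMap.det ((ContinuousLinearMap.id ℂ (Fin n → ℂ) + l.smulRight q : _ →L[ℂ] _) :
      (Fin n → ℂ) →ₗ[ℂ] (Fin n → ℂ)) = 1 + l q :=
  LinearMap.transvection.det (l : (Fin n → ℂ) →ₗ[ℂ] ℂ) q

/-- The derivative is a scalar times a rank one perturbation of the identity: the scalar contributes
its `n`-th power, and the perturbation one further factor `s / (1 - herm z w)`, where `s = √(1 -
|z|²)`. -/
theorem det_ballMobiusDeriv {n : ℕ} {z w : Fin n → ℂ} (hz : z ∈ unitBall n)
    (hw : w ∈ unitBall n) :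
    LinearMap.det (ballMobiusDeriv z w : (Fin n → ℂ) →ₗ[ℂ] (Fin n → ℂ)) =
      (-1) ^ n * (√(1 - normSq z) / (1 - herm z w)) ^ (n + 1) := by
  obtain ⟨hs, hs2⟩ := exists_sqrt_one_sub_normSq hz
  have h1 := one_add_ofReal_ne_zero hs
  have h2 := one_sub_herm_ne_zero hz hw
  have h3 : (√(1 - normSq z) : ℂ) ≠ 0 := by exact_mod_cast hs.ne'
  have h5 : herm z (ballMobius z w) = 1 - (1 - (normSq z : ℂ)) / (1 - herm z w) := by
    rw [← one_sub_herm_ballMobius hz hw]; ring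
  rw [ballMobiusDeriv, ContinuousLinearMap.toLinearMap_smul, LinearMap.det_smul,
    det_id_add_smulRight]
  simp only [map_smul, map_sub, herm_self, smul_eq_mul, h5, Module.finrank_fin_fun]
  have h6 : 1 + (√(1 - normSq z) : ℂ)⁻¹ * ((1 + (√(1 - normSq z) : ℂ))⁻¹ * (normSq z : ℂ) -
      (1 - (1 - (normSq z : ℂ)) / (1 - herm z w))) = √(1 - normSq z) / (1 - herm z w) := by
    rw [hs2]
    set s : ℂ := (√(1 - normSq z) : ℂ)
    field_simp
    ring
  rw [h6, neg_mul, neg_pow, pow_succ _ n, ← div_eq_mul_inv]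
  ring

/-- The real Jacobian of a complex linear map is the squared modulus of its complex determinant. -/
theorem abs_det_real_ballMobiusDeriv {n : ℕ} {z w : Fin n → ℂ} (hz : z ∈ unitBall n)
    (hw : w ∈ unitBall n) :
    |((ballMobiusDeriv z w).restrictScalars ℝ).det| =
      ((1 - normSq z) / ‖1 - herm z w‖ ^ 2) ^ (n + 1) := by
  have h : ((ballMobiusDeriv z w).restrictScalars ℝ).det =
      Complex.normSq (LinearMap.det (ballMobiusDeriv z w : (Fin n → ℂ) →ₗ[ℂ] (Fin n → ℂ))) := by
    rw [← Algebra.norm_complex_apply, ← LinearMap.det_restrictScalars]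
    rfl
  rw [h, abs_of_nonneg (Complex.normSq_nonneg _), det_ballMobiusDeriv hz hw,
    Complex.normSq_eq_norm_sq]
  have h1 : 0 < 1 - normSq z := sub_pos.2 hz
  simp only [norm_mul, norm_pow, norm_neg, norm_one, one_pow, one_mul, norm_div, norm_real,
    Real.norm_eq_abs]
  rw [← pow_mul, mul_comm (n + 1), pow_mul, div_pow, sq_abs, Real.sq_sqrt h1.le]

/-! ### The reproducing kernel for radial power weights. -/

theorem continuousOn_ball_weight {n a : ℕ} {c : ℝ} {φ : (Fin n → ℂ) → ℝ}
    (hφ : ∀ z ∈ unitBall n, φ z = c * (1 - normSq z) ^ a) : ContinuousOn φ (unitBall n) := by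
  refine ContinuousOn.congr (Continuous.continuousOn ?_) hφ
  exact continuous_const.mul ((continuous_const.sub continuous_normSq).pow a)

theorem integrableOn_ball_weight {n a : ℕ} {c : ℝ} (hc : 0 < c) {φ : (Fin n → ℂ) → ℝ}
    (hφ : ∀ z ∈ unitBall n, φ z = c * (1 - normSq z) ^ a) : IntegrableOn φ (unitBall n) := by
  refine IntegrableOn.of_bound (volume_unitBall_lt_top n)
    ((continuousOn_ball_weight hφ).aestronglyMeasurable (measurableSet_unitBall n)) c ?_
  filter_upwards [ae_restrict_mem (measurableSet_unitBall n)] with z hz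
  have h1 : 0 < 1 - normSq z := sub_pos.2 hz
  have h2 : (1 - normSq z) ^ a ≤ 1 := pow_le_one₀ h1.le (by linarith [normSq_nonneg z])
  rw [hφ z hz, Real.norm_of_nonneg (by positivity)]
  exact mul_le_of_le_one_right hc.le h2

theorem differentiableOn_ball_kernel {n : ℕ} (N : ℕ) {w : Fin n → ℂ} (hw : w ∈ unitBall n) :
    DifferentiableOn ℂ (fun z => ((1 - herm w z) ^ N)⁻¹) (unitBall n) := fun z hz => by
  have h := pow_ne_zero N (one_sub_herm_ne_zero hw hz)
  have h' : DifferentiableAt ℂ (fun z => (1 - herm w z) ^ N) z := by fun_prop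
  exact (h'.inv h).differentiableWithinAt

/-- By Cauchy–Schwarz, `|1 - herm w z| ≥ 1 - |w|`. Boundedness puts the kernel in the weighted space
and dominates the reproducing integrand. -/
theorem exists_norm_ball_kernel_le {n : ℕ} (N : ℕ) {w : Fin n → ℂ} (hw : w ∈ unitBall n) :
    ∃ M, ∀ z ∈ unitBall n, ‖((1 - herm w z) ^ N)⁻¹‖ ≤ M := by
  have hr : 0 < 1 - √(normSq w) := by
    rw [sub_pos, Real.sqrt_lt' one_pos, one_pow]
    exact hw
  refine ⟨((1 - √(normSq w)) ^ N)⁻¹, fun z hz => ?_⟩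
  rw [norm_inv, norm_pow]
  have h1 : ‖herm w z‖ ≤ √(normSq w) := by
    refine Real.le_sqrt_of_sq_le ((norm_herm_sq_le w z).trans ?_)
    exact mul_le_of_le_one_right (normSq_nonneg w) (mem_unitBall.1 hz).le
  have h2 : 1 - √(normSq w) ≤ ‖1 - herm w z‖ := by
    have := norm_sub_norm_le 1 (herm w z)
    rw [norm_one] at this
    linarith
  exact inv_anti₀ (by positivity) (pow_le_pow_left₀ hr.le h2 N)

/-- The transformation of the integrand under the involution `ballMobius z`. -/
theorem ball_kernel_comp_ballMobius {n a : ℕ} {z u : Fin n → ℂ} (hz : z ∈ unitBall n)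
    (hu : u ∈ unitBall n) :
    ((((1 - normSq z) / ‖1 - herm z u‖ ^ 2) ^ (n + 1) : ℝ) : ℂ) *
        (((1 - herm (ballMobius z u) z) ^ (n + 1 + a))⁻¹ *
          (((1 - normSq (ballMobius z u)) ^ a : ℝ) : ℂ)) =
      ((1 - herm z u) ^ (n + 1 + a))⁻¹ * ((1 - normSq u : ℝ) : ℂ) ^ a := by
  have hx := one_sub_herm_ne_zero hz hu
  have hx' : conj (1 - herm z u) ≠ 0 := (map_ne_zero _).2 hx
  have hD : (1 - (normSq z : ℂ)) ≠ 0 := by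
    have : 1 - normSq z ≠ 0 := (sub_pos.2 hz).ne'
    exact_mod_cast this
  have h1 : 1 - herm (ballMobius z u) z = (1 - (normSq z : ℂ)) / conj (1 - herm z u) := by
    rw [← conj_herm z (ballMobius z u)]
    have := congrArg conj (one_sub_herm_ballMobius hz hu)
    simpa using this
  rw [h1, one_sub_normSq_ballMobius hz hu]
  push_cast
  rw [← Complex.mul_conj']
  -- With `|1 - herm z u|² = x y`, the powers of `D` and `y` cancel and only `x` to the power `-(n +
  -- 1 + a)` remains.
  generalize conj (1 - herm z u) = y at *
  generalize 1 - herm z u = x at *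
  generalize 1 - (normSq z : ℂ) = D at *
  simp only [div_pow, mul_pow, pow_add _ (n + 1) a]
  field_simp

/-- The weighted Bergman kernel of the unit ball for the weight `c (1 - |z|²)ᵃ`. -/
theorem isWeightedBergmanKernel_unitBall {n a : ℕ} {c : ℝ} (hc : 0 < c) {φ : (Fin n → ℂ) → ℝ}
    (hφ : ∀ z ∈ unitBall n, φ z = c * (1 - normSq z) ^ a) :
    IsWeightedBergmanKernel (unitBall n) φ (fun z w =>
      (((n + a).factorial / (π ^ n * a.factorial * c) : ℝ) : ℂ) *
        ((1 - herm w z) ^ (n + 1 + a))⁻¹) := by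
  have hB := measurableSet_unitBall n
  have hφc := continuousOn_ball_weight hφ
  have hφi := integrableOn_ball_weight hc hφ
  have hφ0 : ∀ z ∈ unitBall n, 0 ≤ φ z := fun z hz => by
    have h1 : 0 < 1 - normSq z := sub_pos.2 hz
    rw [hφ z hz]; positivity
  -- The reciprocal of the total mass of the weight; see `hCc`.
  set C : ℝ := (n + a).factorial / (π ^ n * a.factorial * c) with hC
  refine ⟨fun w hw => ⟨(differentiableOn_ball_kernel _ hw).const_mul _, ?_⟩, fun z hz w hw => ?_,
    fun f hf z hz => ?_⟩
  · obtain ⟨M, hM⟩ := exists_norm_ball_kernel_le (n + 1 + a) hw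
    have hk := ((differentiableOn_ball_kernel (n + 1 + a) hw).const_mul (C : ℂ)).continuousOn
    refine Integrable.mono' (hφi.const_mul ((‖(C : ℂ)‖ * M) ^ 2))
      (((hk.norm.pow 2).mul hφc).aestronglyMeasurable hB) ?_
    filter_upwards [ae_restrict_mem hB] with z hz
    have h0 := hφ0 z hz
    rw [Real.norm_of_nonneg (by positivity), norm_mul]
    gcongr
    exact hM z hz
  · simp only [map_mul, conj_ofReal, map_inv₀, map_pow, map_sub, map_one, conj_herm]
  · obtain ⟨M, hM⟩ := exists_norm_ball_kernel_le (n + 1 + a) hz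
    have hM0 : 0 ≤ M := (norm_nonneg _).trans (hM z hz)
    have hconj : ∀ w, 1 - herm w z = conj (1 - herm z w) := fun w => by simp [conj_herm]
    have hk := (differentiableOn_ball_kernel (n + 1 + a) hz).continuousOn
    have hk' : ContinuousOn (fun w => (C : ℂ) * ((1 - herm w z) ^ (n + 1 + a))⁻¹) (unitBall n) := by
      have := continuousOn_const (c := (C : ℂ)).mul (continuous_conj.comp_continuousOn hk)
      refine this.congr fun w _ => ?_
      simp only [Pi.mul_apply, Function.comp_apply, hconj, map_inv₀, map_pow]
    have hG : IntegrableOn (fun w => (C : ℂ) * ((1 - herm w z) ^ (n + 1 + a))⁻¹ * f w * (φ w : ℂ))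
        (unitBall n) := by
      refine Integrable.mono' ((hf.2.add hφi).const_mul (‖(C : ℂ)‖ * M))
        (((hk'.mul hf.1.continuousOn).mul
          (continuous_ofReal.comp_continuousOn hφc)).aestronglyMeasurable hB) ?_
      filter_upwards [ae_restrict_mem hB] with w hw
      have h0 := hφ0 w hw
      have h1 : ‖((1 - herm w z) ^ (n + 1 + a))⁻¹‖ ≤ M := by
        rw [hconj, ← map_pow, ← map_inv₀, norm_conj]
        exact hM w hw
      have h2 : ‖f w‖ ≤ ‖f w‖ ^ 2 + 1 := by nlinarith [sq_nonneg (‖f w‖ - 1), norm_nonneg (f w)]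
      rw [norm_mul, norm_mul, norm_mul, norm_real (φ w), Real.norm_of_nonneg h0, mul_assoc]
      refine mul_le_mul (by gcongr) ?_ (by positivity) (by positivity)
      simp only [Pi.add_apply]
      nlinarith
    have hderiv : ∀ u ∈ unitBall n, HasFDerivWithinAt (ballMobius z)
        ((ballMobiusDeriv z u).restrictScalars ℝ) (unitBall n) u := fun u hu =>
      ((hasFDerivAt_ballMobius hz hu).restrictScalars ℝ).hasFDerivWithinAt
    have hinj := injOn_ballMobius hz
    -- The substitution `w = ballMobius z u` replaces the kernel, antiholomorphic in `w`, by a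
    -- factor holomorphic in `u`, so the mean value property applies.
    have hcomp : ∀ u ∈ unitBall n, |((ballMobiusDeriv z u).restrictScalars ℝ).det| •
        ((C : ℂ) * ((1 - herm (ballMobius z u) z) ^ (n + 1 + a))⁻¹ * f (ballMobius z u) *
          (φ (ballMobius z u) : ℂ)) =
        ((C * c : ℝ) : ℂ) * (f (ballMobius z u) * ((1 - herm z u) ^ (n + 1 + a))⁻¹ *
          ((1 - normSq u : ℝ) : ℂ) ^ a) := fun u hu => by
      rw [abs_det_real_ballMobiusDeriv hz hu, real_smul, hφ _ (ballMobius_mem hz hu), mul_assoc (f _),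
        ← ball_kernel_comp_ballMobius hz hu]
      push_cast
      ring
    have hCc : C * c * (π ^ n * a.factorial / (n + a).factorial) = 1 := by
      rw [hC]; field_simp
    have hCc0 : ((C * c : ℝ) : ℂ) ≠ 0 := by
      exact_mod_cast left_ne_zero_of_mul_eq_one hCc
    have hint := hG
    conv at hint => arg 2; rw [← image_ballMobius hz]
    rw [integrableOn_image_iff_integrableOn_abs_det_fderiv_smul volume hB hderiv hinj,
      integrableOn_congr_fun hcomp hB] at hint
    have hint' : IntegrableOn (fun u => f (ballMobius z u) * ((1 - herm z u) ^ (n + 1 + a))⁻¹ *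
          ((1 - normSq u : ℝ) : ℂ) ^ a) (unitBall n) :=
      (integrable_const_mul_iff (isUnit_iff_ne_zero.2 hCc0) _).1 hint
    have hhol : DifferentiableOn ℂ (fun u => f (ballMobius z u) *
        ((1 - herm z u) ^ (n + 1 + a))⁻¹) (unitBall n) :=
      (hf.1.comp (fun u hu => (hasFDerivAt_ballMobius hz hu).differentiableAt.differentiableWithinAt)
        fun u hu => ballMobius_mem hz hu).mul (differentiableOn_ball_kernel _ hz)
    have hmean := integral_ball_radial hhol hint'
    conv_rhs => rw [← image_ballMobius hz]
    rw [integral_image_eq_integral_abs_det_fderiv_smul volume hB hderiv hinj,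
      setIntegral_congr_fun hB hcomp, integral_const_mul, hmean, ballMobius_zero, mul_left_comm,
      ← ofReal_mul, hCc]
    simp

/-! ### The kernel of order `d` on the diagonal. -/

theorem weightedBergmanKernel_spec {n : ℕ} {D : Set (Fin n → ℂ)} {φ : (Fin n → ℂ) → ℝ}
    {K : (Fin n → ℂ) → (Fin n → ℂ) → ℂ} (hK : IsWeightedBergmanKernel D φ K) :
    IsWeightedBergmanKernel D φ (weightedBergmanKernel D φ) := by
  have h : ∃ K, IsWeightedBergmanKernel D φ K := ⟨K, hK⟩
  rw [weightedBergmanKernel, dif_pos h]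
  exact h.choose_spec

theorem weightedBergmanKernel_eq {n : ℕ} {D : Set (Fin n → ℂ)} (hD : MeasurableSet D)
    {φ : (Fin n → ℂ) → ℝ} {K : (Fin n → ℂ) → (Fin n → ℂ) → ℂ}
    (hK : IsWeightedBergmanKernel D φ K) {z w : Fin n → ℂ} (hz : z ∈ D) (hw : w ∈ D) :
    weightedBergmanKernel D φ z w = K z w :=
  (weightedBergmanKernel_spec hK).unique hD hK hz hw

theorem bergmanDiag_unitBall {n : ℕ} {z : Fin n → ℂ} (hz : z ∈ unitBall n) :
    bergmanDiag (unitBall n) z = n.factorial / π ^ n * ((1 - normSq z) ^ (n + 1))⁻¹ := by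
  have hK := isWeightedBergmanKernel_unitBall (n := n) (a := 0) (c := 1) one_pos
    (φ := fun _ => 1) (by simp)
  rw [bergmanDiag, weightedBergmanKernel_eq (measurableSet_unitBall n) hK hz hz, herm_self,
    ← ofReal_re (n.factorial / π ^ n * ((1 - normSq z) ^ (n + 1))⁻¹)]
  congr 1
  push_cast
  simp

theorem nsWeight_unitBall {n : ℕ} (d : ℕ) {z : Fin n → ℂ} (hz : z ∈ unitBall n) :
    nsWeight (unitBall n) d z = (π ^ n / n.factorial) ^ d * (1 - normSq z) ^ (d * (n + 1)) := by
  rw [nsWeight, bergmanDiag_unitBall hz, mul_comm d, pow_mul, ← mul_pow, ← inv_pow]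
  congr 1
  rw [mul_inv, inv_inv, inv_div]

theorem isWeightedBergmanKernel_nsWeight (n d : ℕ) :
    IsWeightedBergmanKernel (unitBall n) (nsWeight (unitBall n) d) (fun z w =>
      (((n + d * (n + 1)).factorial /
        (π ^ n * (d * (n + 1)).factorial * (π ^ n / n.factorial) ^ d) : ℝ) : ℂ) *
          ((1 - herm w z) ^ (n + 1 + d * (n + 1)))⁻¹) :=
  isWeightedBergmanKernel_unitBall (by positivity) fun _ hz => nsWeight_unitBall d hz

theorem nsConst_eq (n d : ℕ) : nsConst n d =
    (n + d * (n + 1)).factorial / (n.factorial * (d * (n + 1)).factorial) := by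
  -- Both Gamma arguments are written as a natural number plus one, to become factorials.
  rw [nsConst, show ((d : ℝ) + 1) * (n + 1) = ((n + d * (n + 1) : ℕ) : ℝ) + 1 by push_cast; ring,
    show (d : ℝ) * (n + 1) + 1 = ((d * (n + 1) : ℕ) : ℝ) + 1 by push_cast; ring,
    Real.Gamma_nat_eq_factorial, Real.Gamma_nat_eq_factorial]

theorem nsDiag_unitBall {n : ℕ} (d : ℕ) {z : Fin n → ℂ} (hz : z ∈ unitBall n) :
    nsDiag (unitBall n) d z = nsConst n d * ((n.factorial : ℝ) / π ^ n) ^ (d + 1) *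
      (1 / (1 - normSq z) ^ ((d + 1) * (n + 1))) := by
  rw [nsDiag, nsKernel, weightedBergmanKernel_eq (measurableSet_unitBall n)
    (isWeightedBergmanKernel_nsWeight n d) hz hz, herm_self, nsConst_eq, ← ofReal_one, ← ofReal_sub,
    ← ofReal_pow, ← ofReal_inv, ← ofReal_mul, ofReal_re,
    show n + 1 + d * (n + 1) = (d + 1) * (n + 1) by ring, pow_succ _ d, div_pow, div_pow]
  field_simp

/-! ### Wirtinger calculus. -/

/-- `f` is real differentiable at `z` with Wirtinger derivatives `∂f/∂z_α = a α` and
`∂f/∂z̄_α = b α`. -/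
structure HasWirtinger {n : ℕ} (f : (Fin n → ℂ) → ℂ) (a b : Fin n → ℂ) (z : Fin n → ℂ) : Prop where
  differentiableAt : DifferentiableAt ℝ f z
  dz_eq : ∀ α, dz α f z = a α
  dzbar_eq : ∀ α, dzbar α f z = b α

namespace HasWirtinger

variable {n : ℕ} {f g : (Fin n → ℂ) → ℂ} {a b a' b' z : Fin n → ℂ}

/-- Allows differentiating, repeatedly, formulas that hold only on the open ball. -/
theorem congr_of_eventuallyEq (hf : HasWirtinger f a b z) (h : g =ᶠ[𝓝 z] f) :
    HasWirtinger g a b z := by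
  refine ⟨hf.1.congr_of_eventuallyEq h, fun α => ?_, fun α => ?_⟩
  · rw [← hf.2, dz, dz, h.fderiv_eq]
  · rw [← hf.3, dzbar, dzbar, h.fderiv_eq]

theorem congr_coeff (hf : HasWirtinger f a b z) (ha : ∀ α, a α = a' α) (hb : ∀ α, b α = b' α) :
    HasWirtinger f a' b' z :=
  ⟨hf.1, fun α => (hf.2 α).trans (ha α), fun α => (hf.3 α).trans (hb α)⟩

protected theorem const (c : ℂ) (z : Fin n → ℂ) : HasWirtinger (fun _ => c) 0 0 z := by
  refine ⟨differentiableAt_const c, fun α => ?_, fun α => ?_⟩ <;> simp [dz, dzbar]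

protected theorem add (hf : HasWirtinger f a b z) (hg : HasWirtinger g a' b' z) :
    HasWirtinger (fun w => f w + g w) (a + a') (b + b') z := by
  refine ⟨hf.1.add hg.1, fun α => ?_, fun α => ?_⟩
  · rw [Pi.add_apply, ← hf.2, ← hg.2, dz, fderiv_fun_add hf.1 hg.1]
    simp only [dz, _root_.add_apply]
    ring
  · rw [Pi.add_apply, ← hf.3, ← hg.3, dzbar, fderiv_fun_add hf.1 hg.1]
    simp only [dzbar, _root_.add_apply]
    ring

protected theorem mul (hf : HasWirtinger f a b z) (hg : HasWirtinger g a' b' z) :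
    HasWirtinger (fun w => f w * g w) (fun α => a α * g z + f z * a' α)
      (fun α => b α * g z + f z * b' α) z := by
  refine ⟨hf.1.mul hg.1, fun α => ?_, fun α => ?_⟩
  · rw [← hf.2, ← hg.2, dz, fderiv_fun_mul hf.1 hg.1]
    simp only [dz, _root_.add_apply, _root_.smul_apply, smul_eq_mul]
    ring
  · rw [← hf.3, ← hg.3, dzbar, fderiv_fun_mul hf.1 hg.1]
    simp only [dzbar, _root_.add_apply, _root_.smul_apply, smul_eq_mul]
    ring

protected theorem sum {ι : Type*} {F : ι → (Fin n → ℂ) → ℂ} {A B : ι → Fin n → ℂ} (s : Finset ι)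
    (h : ∀ i, HasWirtinger (F i) (A i) (B i) z) :
    HasWirtinger (fun w => ∑ i ∈ s, F i w) (∑ i ∈ s, A i) (∑ i ∈ s, B i) z := by
  classical
  induction s using Finset.induction_on with
  | empty => simpa using HasWirtinger.const 0 z
  | insert i s hi ih => simpa only [Finset.sum_insert hi] using (h i).add ih

/-- Since the outer function is holomorphic, its chain rule does not mix the two kinds of
derivative. -/
theorem comp_hasDerivAt {F : ℂ → ℂ} {F' : ℂ} (hF : HasDerivAt F F' (f z))
    (hf : HasWirtinger f a b z) :
    HasWirtinger (fun w => F (f w)) (fun α => F' * a α) (fun α => F' * b α) z := by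
  have h := (hF.hasFDerivAt.restrictScalars ℝ).comp z hf.1.hasFDerivAt
  have hv : ∀ v, fderiv ℝ (fun w => F (f w)) z v = F' * fderiv ℝ f z v := fun v => by
    rw [show fderiv ℝ (fun w => F (f w)) z = _ from h.fderiv]
    simp [mul_comm]
  refine ⟨h.differentiableAt, fun α => ?_, fun α => ?_⟩
  · rw [← hf.2, dz, hv, hv, dz]; ring
  · rw [← hf.3, dzbar, hv, hv, dzbar]; ring

theorem coord (i : Fin n) (z : Fin n → ℂ) :
    HasWirtinger (fun w => w i) (fun α => if α = i then 1 else 0) 0 z := by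
  have h : HasFDerivAt (fun w : Fin n → ℂ => w i)
    (ContinuousLinearMap.proj (R := ℝ) (φ := fun _ : Fin n => ℂ) i) z := hasFDerivAt_apply i z
  refine ⟨h.differentiableAt, fun α => ?_, fun α => ?_⟩
  · rw [dz, h.fderiv]
    by_cases hi : α = i
    · subst hi; simp
    · simp [hi, Ne.symm hi]
  · rw [dzbar, h.fderiv]
    by_cases hi : α = i
    · subst hi; simp
    · simp [Ne.symm hi]

theorem conj_coord (i : Fin n) (z : Fin n → ℂ) :
    HasWirtinger (fun w => conj (w i)) 0 (fun α => if α = i then 1 else 0) z := by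
  have h : HasFDerivAt (fun w : Fin n → ℂ => conj (w i)) ((conjCLE : ℂ →L[ℝ] ℂ).comp
    (ContinuousLinearMap.proj (R := ℝ) (φ := fun _ : Fin n => ℂ) i)) z :=
    (conjCLE : ℂ →L[ℝ] ℂ).hasFDerivAt.comp z (hasFDerivAt_apply i z)
  refine ⟨h.differentiableAt, fun α => ?_, fun α => ?_⟩
  · rw [dz, h.fderiv]
    by_cases hi : α = i
    · subst hi; simp
    · simp [Ne.symm hi]
  · rw [dzbar, h.fderiv]
    by_cases hi : α = i
    · subst hi; simp
    · simp [hi, Ne.symm hi]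

end HasWirtinger

theorem ofReal_normSq {n : ℕ} (z : Fin n → ℂ) : (normSq z : ℂ) = ∑ i, z i * conj (z i) := by
  rw [← herm_self, herm_apply]

theorem hasWirtinger_one_sub_normSq {n : ℕ} (z : Fin n → ℂ) :
    HasWirtinger (fun w => 1 - (normSq w : ℂ)) (fun α => -conj (z α)) (fun α => -z α) z := by
  have h := (HasWirtinger.const (1 : ℂ) z).add ((HasWirtinger.const (-1 : ℂ) z).mul
    (HasWirtinger.sum Finset.univ fun i =>
      (HasWirtinger.coord i z).mul (HasWirtinger.conj_coord i z)))
  refine (h.congr_of_eventuallyEq (.of_forall fun w => ?_)).congr_coeff (fun α => ?_) fun α => ?_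
  · simp only [ofReal_normSq]; ring
  · simp [Finset.sum_apply]
  · simp [Finset.sum_apply]

theorem one_sub_ofReal_normSq_ne_zero {n : ℕ} {z : Fin n → ℂ} (hz : z ∈ unitBall n) :
    1 - (normSq z : ℂ) ≠ 0 := by
  have : 1 - normSq z ≠ 0 := (sub_pos.2 hz).ne'
  exact_mod_cast this

theorem hasWirtinger_inv_one_sub_normSq {n : ℕ} {z : Fin n → ℂ} (hz : z ∈ unitBall n) :
    HasWirtinger (fun w => (1 - (normSq w : ℂ))⁻¹)
      (fun α => conj (z α) * (1 - (normSq z : ℂ))⁻¹ ^ 2)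
      (fun α => z α * (1 - (normSq z : ℂ))⁻¹ ^ 2) z := by
  refine (HasWirtinger.comp_hasDerivAt (hasDerivAt_inv (one_sub_ofReal_normSq_ne_zero hz))
    (hasWirtinger_one_sub_normSq z)).congr_coeff (fun α => ?_) fun α => ?_ <;>
  rw [inv_pow, neg_mul_neg, mul_comm]

/-- The free constants serve both `log K_{D,d}` and `log g_{D,d}`. -/
theorem hasWirtinger_log_one_sub_normSq {n : ℕ} {z : Fin n → ℂ} (hz : z ∈ unitBall n) (c k : ℂ) :
    HasWirtinger (fun w => c + k * Complex.log (1 - (normSq w : ℂ)))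
      (fun α => -k * conj (z α) * (1 - (normSq z : ℂ))⁻¹)
      (fun α => -k * z α * (1 - (normSq z : ℂ))⁻¹) z := by
  have hpos : 0 < 1 - normSq z := sub_pos.2 hz
  have hs : 1 - (normSq z : ℂ) ∈ slitPlane := by
    rw [← ofReal_one, ← ofReal_sub]
    exact ofReal_mem_slitPlane.2 hpos
  refine ((HasWirtinger.const c z).add ((HasWirtinger.const k z).mul
    (HasWirtinger.comp_hasDerivAt (Complex.hasDerivAt_log hs)
      (hasWirtinger_one_sub_normSq z)))).congr_coeff (fun α => ?_) fun α => ?_ <;>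
  · simp only [Pi.add_apply, Pi.zero_apply]
    ring

/-- The complex Hessian of `c + k log (1 - |z|²)` on the ball. -/
theorem dz_dzbar_of_eq_log {n : ℕ} {f : (Fin n → ℂ) → ℂ} {c k : ℂ}
    (hf : ∀ w ∈ unitBall n, f w = c + k * Complex.log (1 - (normSq w : ℂ)))
    {z : Fin n → ℂ} (hz : z ∈ unitBall n) (α β : Fin n) :
    dz α (dzbar β f) z = -k * ((if α = β then 1 else 0) * (1 - (normSq z : ℂ))⁻¹ +
      conj (z α) * z β * (1 - (normSq z : ℂ))⁻¹ ^ 2) := by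
  have hnhds : ∀ w ∈ unitBall n, unitBall n ∈ 𝓝 w := fun w hw => (isOpen_unitBall n).mem_nhds hw
  have h1 : ∀ w ∈ unitBall n, dzbar β f w = -k * w β * (1 - (normSq w : ℂ))⁻¹ := fun w hw =>
    ((hasWirtinger_log_one_sub_normSq hw c k).congr_of_eventuallyEq
      (Filter.eventuallyEq_of_mem (hnhds w hw) hf)).dzbar_eq β
  rw [(((((HasWirtinger.const (-k) z).mul (HasWirtinger.coord β z)).mul
    (hasWirtinger_inv_one_sub_normSq hz))).congr_of_eventuallyEq
      (Filter.eventuallyEq_of_mem (hnhds z hz) h1)).dz_eq α]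
  simp only [Pi.zero_apply]
  ring

/-! ### The metric, its determinant, the invariant `β` and the inverse. -/

/-- The constant `(d + 1)(n + 1)`. -/
def nsExponent (n d : ℕ) : ℂ := ((d : ℂ) + 1) * ((n : ℂ) + 1)

theorem nsExponent_ne_zero (n d : ℕ) : nsExponent n d ≠ 0 :=
  mul_ne_zero (Nat.cast_add_one_ne_zero d) (Nat.cast_add_one_ne_zero n)

theorem nsConst_pos (n d : ℕ) : 0 < nsConst n d := by
  rw [nsConst_eq]; positivity

theorem ofReal_log_div_pow {x c : ℝ} (hc : 0 < c) (hx : 0 < x) (N : ℕ) :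
    ((Real.log (c * (1 / x ^ N)) : ℝ) : ℂ) = (Real.log c : ℂ) + -(N : ℂ) * Complex.log (x : ℂ) := by
  rw [Real.log_mul hc.ne' (by positivity), one_div, Real.log_inv, Real.log_pow, ← ofReal_log hx.le]
  push_cast
  ring

theorem nsMetric_unitBall {n : ℕ} (d : ℕ) {z : Fin n → ℂ} (hz : z ∈ unitBall n) (α β : Fin n) :
    nsMetric (unitBall n) d z α β = nsExponent n d * ((if α = β then 1 else 0) *
      (1 - (normSq z : ℂ))⁻¹ + conj (z α) * z β * (1 - (normSq z : ℂ))⁻¹ ^ 2) := by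
  have hlog : ∀ w ∈ unitBall n, ((Real.log (nsDiag (unitBall n) d w) : ℝ) : ℂ) =
      (Real.log (nsConst n d * ((n.factorial : ℝ) / π ^ n) ^ (d + 1)) : ℂ) +
        -nsExponent n d * Complex.log (1 - (normSq w : ℂ)) := fun w hw => by
    have hw' : 0 < 1 - normSq w := sub_pos.2 hw
    have := nsConst_pos n d
    rw [nsDiag_unitBall d hw, ofReal_log_div_pow (by positivity) hw', nsExponent]
    push_cast
    rfl
  rw [nsMetric, Matrix.of_apply, dz_dzbar_of_eq_log hlog hz, neg_neg]

/-- Matrix determinant lemma: the rank one part contributes `1 + |z|² / (1 - |z|²) = 1 / (1 -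
|z|²)`. -/
theorem det_nsMetric_unitBall {n : ℕ} (d : ℕ) {z : Fin n → ℂ} (hz : z ∈ unitBall n) :
    (nsMetric (unitBall n) d z).det =
      nsExponent n d ^ n * (1 - (normSq z : ℂ))⁻¹ ^ (n + 1) := by
  have hU := one_sub_ofReal_normSq_ne_zero hz
  have h : nsMetric (unitBall n) d z = (nsExponent n d * (1 - (normSq z : ℂ))⁻¹) •
      (1 + Matrix.replicateCol Unit (fun i => (1 - (normSq z : ℂ))⁻¹ * conj (z i)) *
        Matrix.replicateRow Unit z) := by
    ext i j
    rw [nsMetric_unitBall d hz]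
    simp only [Matrix.smul_apply, Matrix.add_apply, Matrix.one_apply, Matrix.mul_apply,
      Matrix.replicateCol_apply, Matrix.replicateRow_apply, Finset.univ_unique, smul_eq_mul,
      Finset.sum_const, Finset.card_singleton, one_smul]
    ring
  have hdot : z ⬝ᵥ (fun i => (1 - (normSq z : ℂ))⁻¹ * conj (z i)) =
      (1 - (normSq z : ℂ))⁻¹ * (normSq z : ℂ) := by
    rw [ofReal_normSq, dotProduct, Finset.mul_sum]
    exact Finset.sum_congr rfl fun i _ => by ring
  rw [h, Matrix.det_smul, Matrix.det_one_add_replicateCol_mul_replicateRow, hdot, Fintype.card_fin,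
    mul_pow, pow_succ _ n]
  field_simp
  ring

theorem nsVolume_unitBall {n : ℕ} (d : ℕ) {z : Fin n → ℂ} (hz : z ∈ unitBall n) :
    nsVolume (unitBall n) d z =
      ((d : ℝ) + 1) ^ n * ((n : ℝ) + 1) ^ n / (1 - normSq z) ^ (n + 1) := by
  rw [nsVolume, det_nsMetric_unitBall d hz, nsExponent,
    ← ofReal_re (((d : ℝ) + 1) ^ n * ((n : ℝ) + 1) ^ n / (1 - normSq z) ^ (n + 1))]
  congr 1
  push_cast
  rw [mul_pow, inv_pow, div_eq_mul_inv]

theorem det_nsMetric_eq_nsVolume {n : ℕ} (d : ℕ) {z : Fin n → ℂ} (hz : z ∈ unitBall n) :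
    (nsMetric (unitBall n) d z).det = (nsVolume (unitBall n) d z : ℂ) := by
  rw [det_nsMetric_unitBall d hz, nsVolume_unitBall d hz, nsExponent]
  push_cast
  rw [mul_pow, inv_pow, div_eq_mul_inv]

theorem nsBeta_unitBall {n : ℕ} (d : ℕ) {z : Fin n → ℂ} (hz : z ∈ unitBall n) :
    nsBeta (unitBall n) d z = ((d : ℝ) + 1) ^ n * ((n : ℝ) + 1) ^ n *
      (1 / nsConst n d) ^ (1 / ((d : ℝ) + 1)) * (π ^ n / (n.factorial : ℝ)) := by
  have hu : 0 < 1 - normSq z := sub_pos.2 hz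
  have hc := nsConst_pos n d
  -- Apart from the constant, the kernel is an exact `(d + 1)`-st power; its root cancels the
  -- `z`-dependence of the volume density.
  have hK : nsDiag (unitBall n) d z =
      nsConst n d * (((n.factorial : ℝ) / π ^ n) * ((1 - normSq z) ^ (n + 1))⁻¹) ^ (d + 1) := by
    rw [nsDiag_unitBall d hz, mul_pow, inv_pow, ← pow_mul, mul_comm (n + 1), one_div, mul_assoc]
  have hA : 0 < ((n.factorial : ℝ) / π ^ n) * ((1 - normSq z) ^ (n + 1))⁻¹ := by positivity
  have hr := Real.pow_rpow_inv_natCast hA.le (Nat.succ_ne_zero d)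
  rw [Nat.cast_succ] at hr
  rw [nsBeta, nsVolume_unitBall d hz, hK, Real.rpow_neg (by positivity), one_div ((d : ℝ) + 1),
    Real.mul_rpow hc.le (by positivity), hr, one_div (nsConst n d), Real.inv_rpow hc.le]
  have : 0 < nsConst n d ^ ((d : ℝ) + 1)⁻¹ := by positivity
  field_simp

/-- The Sherman–Morrison formula, checked as a right inverse. -/
theorem inv_nsMetric_unitBall {n : ℕ} (d : ℕ) {z : Fin n → ℂ} (hz : z ∈ unitBall n)
    (μ ν : Fin n) : (nsMetric (unitBall n) d z)⁻¹ μ ν =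
      (1 - (normSq z : ℂ)) / nsExponent n d * ((if μ = ν then 1 else 0) - conj (z μ) * z ν) := by
  have hU := one_sub_ofReal_normSq_ne_zero hz
  have hN := nsExponent_ne_zero n d
  have h : nsMetric (unitBall n) d z * Matrix.of (fun μ ν : Fin n => (1 - (normSq z : ℂ)) /
      nsExponent n d * ((if μ = ν then 1 else 0) - conj (z μ) * z ν)) = 1 := by
    ext β ν
    have h1 : ∀ μ, nsMetric (unitBall n) d z β μ * ((1 - (normSq z : ℂ)) /
        nsExponent n d * ((if μ = ν then 1 else 0) - conj (z μ) * z ν)) =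
        (if β = μ then (if μ = ν then 1 else 0) - conj (z μ) * z ν else 0) +
        (if μ = ν then conj (z β) * z μ * (1 - (normSq z : ℂ))⁻¹ else 0) -
        conj (z β) * z ν * (1 - (normSq z : ℂ))⁻¹ * (z μ * conj (z μ)) := fun μ => by
      rw [nsMetric_unitBall d hz]
      split_ifs <;> field_simp <;> ring
    simp only [Matrix.mul_apply, Matrix.of_apply, h1, Finset.sum_sub_distrib,
      Finset.sum_add_distrib, ← Finset.mul_sum, ← ofReal_normSq, Finset.sum_ite_eq,
      Finset.sum_ite_eq', Finset.mem_univ, if_true, Matrix.one_apply]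
    field_simp
    ring
  rw [Matrix.inv_eq_right_inv h, Matrix.of_apply]

/-! ### Derivatives of the metric and the curvature tensor. -/

theorem hasWirtinger_nsMetric {n : ℕ} (d : ℕ) {z : Fin n → ℂ} (hz : z ∈ unitBall n)
    (β α : Fin n) :
    HasWirtinger (fun w => nsMetric (unitBall n) d w β α)
      (fun γ => nsExponent n d * (1 - (normSq z : ℂ))⁻¹ ^ 2 *
        ((if β = α then 1 else 0) * conj (z γ) + (if α = γ then 1 else 0) * conj (z β) +
          2 * (1 - (normSq z : ℂ))⁻¹ * conj (z β) * conj (z γ) * z α))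
      (fun δ => nsExponent n d * (1 - (normSq z : ℂ))⁻¹ ^ 2 *
        ((if β = α then 1 else 0) * z δ + (if β = δ then 1 else 0) * z α +
          2 * (1 - (normSq z : ℂ))⁻¹ * z α * z δ * conj (z β))) z := by
  have hi := hasWirtinger_inv_one_sub_normSq hz
  have h := (HasWirtinger.const (nsExponent n d) z).mul
    (((HasWirtinger.const (if β = α then 1 else 0) z).mul hi).add
      (((HasWirtinger.conj_coord β z).mul (HasWirtinger.coord α z)).mul (hi.mul hi)))
  refine (h.congr_of_eventuallyEq (Filter.eventuallyEq_of_mem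
    ((isOpen_unitBall n).mem_nhds hz) fun w hw => ?_)).congr_coeff (fun γ => ?_) fun δ => ?_
  · simp only [nsMetric_unitBall d hw]; ring
  · simp only [Pi.add_apply, Pi.zero_apply, @eq_comm _ γ]
    split_ifs <;> ring
  · simp only [Pi.add_apply, Pi.zero_apply, @eq_comm _ δ]
    split_ifs <;> ring

theorem dz_dzbar_nsMetric {n : ℕ} (d : ℕ) {z : Fin n → ℂ} (hz : z ∈ unitBall n)
    (α β γ δ : Fin n) :
    dz γ (dzbar δ (fun w => nsMetric (unitBall n) d w β α)) z =
      nsExponent n d * (1 - (normSq z : ℂ))⁻¹ ^ 2 *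
        ((if β = α then 1 else 0) * ((if γ = δ then 1 else 0) +
            2 * (1 - (normSq z : ℂ))⁻¹ * conj (z γ) * z δ) +
          (if β = δ then 1 else 0) * ((if γ = α then 1 else 0) +
            2 * (1 - (normSq z : ℂ))⁻¹ * conj (z γ) * z α) +
          2 * (1 - (normSq z : ℂ))⁻¹ * conj (z β) * ((if γ = α then 1 else 0) * z δ +
            (if γ = δ then 1 else 0) * z α +
            3 * (1 - (normSq z : ℂ))⁻¹ * conj (z γ) * z α * z δ)) := by
  have hi := hasWirtinger_inv_one_sub_normSq hz
  have hc := fun c : ℂ => HasWirtinger.const c z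
  have hz' := fun i => HasWirtinger.coord i z
  have h := (((hc (nsExponent n d)).mul (hi.mul hi)).mul
    ((((hc (if β = α then 1 else 0)).mul (hz' δ)).add
      ((hc (if β = δ then 1 else 0)).mul (hz' α))).add
        ((((hc 2).mul hi).mul ((hz' α).mul (hz' δ))).mul (HasWirtinger.conj_coord β z))))
  rw [(h.congr_of_eventuallyEq (Filter.eventuallyEq_of_mem
    ((isOpen_unitBall n).mem_nhds hz) fun w hw => ?_)).dz_eq γ]
  · simp only [Pi.add_apply, Pi.zero_apply]
    ring
  · simp only [(hasWirtinger_nsMetric d hw β α).dzbar_eq δ]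
    split_ifs <;> ring

/-- The curvature tensor of the ball is that of constant holomorphic sectional curvature. -/
theorem nsCurvature_unitBall {n : ℕ} (d : ℕ) {z : Fin n → ℂ} (hz : z ∈ unitBall n)
    (α β γ δ : Fin n) :
    nsCurvature (unitBall n) d z α β γ δ = -(nsExponent n d)⁻¹ *
      (nsMetric (unitBall n) d z β α * nsMetric (unitBall n) d z γ δ +
        nsMetric (unitBall n) d z γ α * nsMetric (unitBall n) d z β δ) := by
  have hU := one_sub_ofReal_normSq_ne_zero hz
  have hN := nsExponent_ne_zero n d
  have hZ : ∑ i, conj (z i) * z i = (normSq z : ℂ) := by simp only [ofReal_normSq, mul_comm]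
  have hZ' : ∑ i, z i * conj (z i) = (normSq z : ℂ) := (ofReal_normSq z).symm
  have hA : ∀ X : Fin n → ℂ, ∑ μ, dz γ (fun w => nsMetric (unitBall n) d w β μ) z * X μ =
      nsExponent n d * (1 - (normSq z : ℂ))⁻¹ ^ 2 * (conj (z γ) * X β + conj (z β) * X γ +
        2 * (1 - (normSq z : ℂ))⁻¹ * conj (z β) * conj (z γ) * ∑ μ, z μ * X μ) := fun X => by
    simp only [(hasWirtinger_nsMetric d hz _ _).dz_eq, mul_assoc, ← Finset.mul_sum, add_mul,
      Finset.sum_add_distrib, ite_mul, one_mul, zero_mul, Finset.sum_ite_eq,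
      Finset.sum_ite_eq', Finset.mem_univ, if_true]
  have hB : ∀ X : Fin n → ℂ, ∑ ν, X ν * dzbar δ (fun w => nsMetric (unitBall n) d w ν α) z =
      nsExponent n d * (1 - (normSq z : ℂ))⁻¹ ^ 2 * (z δ * X α + z α * X δ +
        2 * (1 - (normSq z : ℂ))⁻¹ * z α * z δ * ∑ ν, conj (z ν) * X ν) := fun X => by
    simp only [(hasWirtinger_nsMetric d hz _ _).dzbar_eq, mul_comm (X _), mul_assoc,
      ← Finset.mul_sum, add_mul, Finset.sum_add_distrib, ite_mul, one_mul, zero_mul,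
      Finset.sum_ite_eq', Finset.mem_univ, if_true]
  -- The inverse is a multiple of the identity minus a rank one matrix, so the double sum splits
  -- into a single sum and a product of sums, which `hA` and `hB` evaluate.
  have hsum : ∑ μ, ∑ ν, (nsMetric (unitBall n) d z)⁻¹ μ ν *
      dz γ (fun w => nsMetric (unitBall n) d w β μ) z *
      dzbar δ (fun w => nsMetric (unitBall n) d w ν α) z =
      (1 - (normSq z : ℂ)) / nsExponent n d *
      (∑ μ, dz γ (fun w => nsMetric (unitBall n) d w β μ) z *
          dzbar δ (fun w => nsMetric (unitBall n) d w μ α) z -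
        (∑ μ, dz γ (fun w => nsMetric (unitBall n) d w β μ) z * conj (z μ)) *
          ∑ ν, z ν * dzbar δ (fun w => nsMetric (unitBall n) d w ν α) z) := by
    rw [Finset.sum_mul_sum, ← Finset.sum_sub_distrib, Finset.mul_sum]
    refine Finset.sum_congr rfl fun μ _ => ?_
    have h1 : ∀ ν, (nsMetric (unitBall n) d z)⁻¹ μ ν *
        dz γ (fun w => nsMetric (unitBall n) d w β μ) z *
        dzbar δ (fun w => nsMetric (unitBall n) d w ν α) z =
        (1 - (normSq z : ℂ)) / nsExponent n d * ((if μ = ν then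
          dz γ (fun w => nsMetric (unitBall n) d w β μ) z *
          dzbar δ (fun w => nsMetric (unitBall n) d w ν α) z else 0) -
        dz γ (fun w => nsMetric (unitBall n) d w β μ) z * conj (z μ) *
          (z ν * dzbar δ (fun w => nsMetric (unitBall n) d w ν α) z)) := fun ν => by
      rw [inv_nsMetric_unitBall d hz]
      split_ifs <;> ring
    simp only [h1, ← Finset.mul_sum, Finset.sum_sub_distrib, Finset.sum_ite_eq, Finset.mem_univ,
      if_true]
  rw [nsCurvature, dz_dzbar_nsMetric d hz, hsum, hA, hA, hB, hZ, hZ',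
    (hasWirtinger_nsMetric d hz _ _).dzbar_eq, (hasWirtinger_nsMetric d hz _ _).dzbar_eq]
  simp only [nsMetric_unitBall d hz]
  -- In terms of `U`, with `|z|² = 1 - U`, the claim is a rational identity with the coordinates and
  -- Kronecker deltas as atoms.
  obtain ⟨U, hUz⟩ : ∃ U : ℂ, U = 1 - (normSq z : ℂ) := ⟨_, rfl⟩
  have hzU : (normSq z : ℂ) = 1 - U := by rw [hUz]; ring
  rw [← hUz] at hU ⊢
  rw [hzU]
  field_simp
  ring

/-! ### Sectional and Ricci curvature. -/

theorem nsLengthSq_unitBall {n : ℕ} (d : ℕ) {z : Fin n → ℂ} (hz : z ∈ unitBall n)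
    (v : Fin n → ℂ) : nsLengthSq (unitBall n) d z v = nsExponent n d *
      ((normSq v : ℂ) * (1 - (normSq z : ℂ))⁻¹ +
        (‖herm z v‖ : ℂ) ^ 2 * (1 - (normSq z : ℂ))⁻¹ ^ 2) := by
  have h : ∀ α β, nsMetric (unitBall n) d z α β * v α * conj (v β) = nsExponent n d *
      ((if α = β then v α * conj (v β) * (1 - (normSq z : ℂ))⁻¹ else 0) +
        v α * conj (z α) * (z β * conj (v β)) * (1 - (normSq z : ℂ))⁻¹ ^ 2) := fun α β => by
    rw [nsMetric_unitBall d hz]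
    split_ifs <;> ring
  simp only [nsLengthSq, h, ← Finset.mul_sum, Finset.sum_add_distrib, Finset.sum_ite_eq,
    Finset.mem_univ, if_true, ← Finset.sum_mul]
  rw [← ofReal_normSq, ← herm_apply, ← herm_apply, ← conj_herm z v, Complex.mul_conj']

theorem nsLengthSq_ne_zero {n : ℕ} (d : ℕ) {z : Fin n → ℂ} (hz : z ∈ unitBall n)
    {v : Fin n → ℂ} (hv : v ≠ 0) : nsLengthSq (unitBall n) d z v ≠ 0 := by
  have hu : 0 < 1 - normSq z := sub_pos.2 hz
  have hv' : 0 < normSq v := by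
    obtain ⟨i, hi⟩ := Function.ne_iff.1 hv
    exact Finset.sum_pos' (fun _ _ => by positivity) ⟨i, Finset.mem_univ i,
      pow_pos (norm_pos_iff.2 hi) 2⟩
  have h : 0 < normSq v * (1 - normSq z)⁻¹ + ‖herm z v‖ ^ 2 * (1 - normSq z)⁻¹ ^ 2 := by positivity
  rw [nsLengthSq_unitBall d hz]
  exact mul_ne_zero (nsExponent_ne_zero n d) (by exact_mod_cast h.ne')

theorem nsHolSecCurv_unitBall {n : ℕ} (d : ℕ) {z : Fin n → ℂ} (hz : z ∈ unitBall n)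
    {v : Fin n → ℂ} (hv : v ≠ 0) :
    nsHolSecCurv (unitBall n) d z v = -2 / nsExponent n d := by
  have hL := nsLengthSq_ne_zero d hz hv
  have hN := nsExponent_ne_zero n d
  set p : Fin n → Fin n → ℂ := fun α β => nsMetric (unitBall n) d z α β * v α * conj (v β) with hp
  have hpL : ∑ α, ∑ β, p α β = nsLengthSq (unitBall n) d z v := rfl
  have hpL' : ∑ β, ∑ α, p α β = nsLengthSq (unitBall n) d z v := by
    rw [Finset.sum_comm, hpL]
  -- Contracted with `v`, each of the two products of metric entries sums to the square of the
  -- squared length, whence the factor `2`.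
  have hterm : ∀ α β γ δ, nsCurvature (unitBall n) d z α β γ δ * conj (v α) * v β * v γ *
      conj (v δ) = -(nsExponent n d)⁻¹ * (p β α * p γ δ + p γ α * p β δ) := fun α β γ δ => by
    rw [nsCurvature_unitBall d hz, hp]
    ring
  simp only [nsHolSecCurv, hterm, ← Finset.mul_sum, Finset.sum_add_distrib, ← Finset.sum_mul, hpL,
    hpL']
  field_simp
  ring

theorem nsRicci_unitBall {n : ℕ} (d : ℕ) {z : Fin n → ℂ} (hz : z ∈ unitBall n)
    {v : Fin n → ℂ} (hv : v ≠ 0) : nsRicci (unitBall n) d z v = -1 / ((d : ℂ) + 1) := by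
  have hL := nsLengthSq_ne_zero d hz hv
  have hd : (d : ℂ) + 1 ≠ 0 := Nat.cast_add_one_ne_zero d
  have hlog : ∀ w ∈ unitBall n, ((Real.log (nsVolume (unitBall n) d w) : ℝ) : ℂ) =
      (Real.log (((d : ℝ) + 1) ^ n * ((n : ℝ) + 1) ^ n) : ℂ) +
        -((n : ℂ) + 1) * Complex.log (1 - (normSq w : ℂ)) := fun w hw => by
    have hw' : 0 < 1 - normSq w := sub_pos.2 hw
    rw [nsVolume_unitBall d hw, div_eq_mul_one_div, ofReal_log_div_pow (by positivity) hw']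
    push_cast
    rfl
  -- The Einstein property: the logarithms of volume and kernel have coefficients `-(n + 1)` and
  -- `-(d + 1)(n + 1)`, so their Hessians are proportional.
  have hric : ∀ α β, nsRicciTensor (unitBall n) d z α β * v α * conj (v β) =
      -1 / ((d : ℂ) + 1) * (nsMetric (unitBall n) d z α β * v α * conj (v β)) := fun α β => by
    rw [nsRicciTensor, dz_dzbar_of_eq_log hlog hz, nsMetric_unitBall d hz, nsExponent]
    field_simp
  simp only [nsRicci, hric, ← Finset.mul_sum]
  exact mul_div_cancel_right₀ _ hL

end NarasimhanSimha

theorem corollary2p4 (n d : ℕ) (hn : 1 ≤ n) :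
    NarasimhanSimha.IsWeightedBergmanKernel (NarasimhanSimha.unitBall n)
      (NarasimhanSimha.nsWeight (NarasimhanSimha.unitBall n) d)
      (NarasimhanSimha.nsKernel (NarasimhanSimha.unitBall n) d) ∧
    ∀ z ∈ NarasimhanSimha.unitBall n,
      NarasimhanSimha.nsDiag (NarasimhanSimha.unitBall n) d z =
        NarasimhanSimha.nsConst n d * ((n.factorial : ℝ) / Real.pi ^ n) ^ (d + 1) *
          (1 / (1 - NarasimhanSimha.normSq z) ^ ((d + 1) * (n + 1))) ∧
      (∀ α β : Fin n,
        NarasimhanSimha.nsMetric (NarasimhanSimha.unitBall n) d z α β =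
          ((d : ℂ) + 1) * ((n : ℂ) + 1) *
            ((if α = β then 1 else 0) / (1 - (NarasimhanSimha.normSq z : ℂ)) +
              starRingEnd ℂ (z α) * z β / (1 - (NarasimhanSimha.normSq z : ℂ)) ^ 2)) ∧
      (NarasimhanSimha.nsMetric (NarasimhanSimha.unitBall n) d z).det =
        (NarasimhanSimha.nsVolume (NarasimhanSimha.unitBall n) d z : ℂ) ∧
      NarasimhanSimha.nsVolume (NarasimhanSimha.unitBall n) d z =
        ((d : ℝ) + 1) ^ n * ((n : ℝ) + 1) ^ n / (1 - NarasimhanSimha.normSq z) ^ (n + 1) ∧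
      NarasimhanSimha.nsBeta (NarasimhanSimha.unitBall n) d z =
        ((d : ℝ) + 1) ^ n * ((n : ℝ) + 1) ^ n *
          (1 / NarasimhanSimha.nsConst n d) ^ (1 / ((d : ℝ) + 1)) *
          (Real.pi ^ n / (n.factorial : ℝ)) ∧
      ∀ v : Fin n → ℂ, v ≠ 0 →
        NarasimhanSimha.nsHolSecCurv (NarasimhanSimha.unitBall n) d z v =
          -2 / (((d : ℂ) + 1) * ((n : ℂ) + 1)) ∧
        NarasimhanSimha.nsRicci (NarasimhanSimha.unitBall n) d z v = -1 / ((d : ℂ) + 1) := by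
  open NarasimhanSimha in
  refine ⟨weightedBergmanKernel_spec (isWeightedBergmanKernel_nsWeight n d), fun z hz =>
    ⟨nsDiag_unitBall d hz, fun α β => ?_, det_nsMetric_eq_nsVolume d hz, nsVolume_unitBall d hz,
      nsBeta_unitBall d hz, fun v hv => ⟨nsHolSecCurv_unitBall d hz hv, nsRicci_unitBall d hz hv⟩⟩⟩
  rw [NarasimhanSimha.nsMetric_unitBall d hz, NarasimhanSimha.nsExponent, inv_pow, div_eq_mul_inv,
    div_eq_mul_inv]
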